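/- Let $\Sigma$ and $\Gamma$ be disjoint finite alphabets. An origin graph over $(\Sigma,\Gamma)$ consists of a nonempty input word $u\in\Sigma^+$, an output word $v\in\Gamma^*$ and a map $o$ from the positions of $v$ to the positions of $u$. It is viewed as a relational structure whose domain is the disjoint union of the positions of $u$ and the positions of $v$, with: a unary predicate for each letter of $\Sigma\cup\Gamma$, true at the positions carrying that letter; the binary relation $\leq_{\mathrm{in}}$, which is the linear order on the positions of $u$ (and relates no other elements); the binary relation $\leq_{\mathrm{out}}$, which is the linear order on the positions of $v$ (and relates no other elements); the binary relation $S_{\mathrm{out}}$, where $S_{\mathrm{out}}(x,y)$ holds iff $x,y$ are output positions and $y$ is the immediate successor of $x$; and the unary function $\mathtt{o}$, equal to $o$ on output positions and to the identity on input positions. Let $\mathrm{FO}^2[\Sigma,\Gamma,\leq_{\mathrm{in}},\leq_{\mathrm{out}},S_{\mathrm{out}},\mathtt{o}]$ denote first-order logic with equality over this signature, restricted to formulas that use only two variables $x,y$ (which may be requantified). Proposition. The satisfiability problem of $\mathrm{FO}^2[\Sigma,\Gamma,\leq_{\mathrm{in}},\leq_{\mathrm{out}},S_{\mathrm{out}},\mathtt{o}]$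 over origin graphs is undecidable: there is no algorithm that, given finite alphabets $\Sigma,\Gamma$ and a sentence $\varphi$ of this logic, decides whether some origin graph over $(\Sigma,\Gamma)$ satisfies $\varphi$. Moreover, there are fixed finite alphabets $\Sigma,\Gamma$ for which the satisfiability problem is already undecidable. -/

import Mathlib

/-- An origin graph with input alphabet `A` and output alphabet `B`: a nonempty input word, an
output word, and a map sending every output position to an input position. -/
structure OGraph (A B : Type) where
  input : List A
  input_ne_nil : input ≠ []
  output : List B
  origin : Fin output.length → Fin input.length

namespace OGraph

variable {A B : Type} (G : OGraph A B)

/-- The domain of the structure: the disjoint union of the input and the output positions. -/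
abbrev Dom : Type := Fin G.input.length ⊕ Fin G.output.length

/-- `x` is an input position labelled `a`. -/
def InLabel (a : A) : G.Dom → Prop
  | .inl i => G.input.get i = a
  | .inr _ => False

/-- `x` is an output position labelled `b`. -/
def OutLabel (b : B) : G.Dom → Prop
  | .inl _ => False
  | .inr j => G.output.get j = b

/-- The linear order on the input positions. -/
def LeIn : G.Dom → G.Dom → Prop
  | .inl i, .inl j => i ≤ j
  | _, _ => False

/-- The linear order on the output positions. -/
def LeOut : G.Dom → G.Dom → Prop
  | .inr i, .inr j => i ≤ j
  | _, _ => False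

/-- `SuccOut x y`: both are output positions, and `y` is the one immediately after `x`. -/
def SuccOut : G.Dom → G.Dom → Prop
  | .inr i, .inr j => j.val = i.val + 1
  | _, _ => False

/-- The interpretation of the function symbol `o`: the origin on output positions, the identity
on input positions. -/
def originFun : G.Dom → G.Dom
  | .inl i => .inl i
  | .inr j => .inl (G.origin j)

end OGraph

/-- The two variables. -/
inductive FOVar where
  | x
  | y
  deriving DecidableEq

/-- Terms over the unary function symbol `o` and the two variables. -/
inductive FOTerm where
  | var (v : FOVar)
  | o (t : FOTerm)

/-- Formulas of two-variable first-order logic `FO²[A, B, ≤in, ≤out, S_out, o]`, with equality.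
The two variables can be quantified again inside the scope of another quantifier. -/
inductive FO2 (A B : Type) where
  | eq (s t : FOTerm)
  | inLabel (a : A) (t : FOTerm)
  | outLabel (b : B) (t : FOTerm)
  | leIn (s t : FOTerm)
  | leOut (s t : FOTerm)
  | succOut (s t : FOTerm)
  | neg (φ : FO2 A B)
  | and (φ ψ : FO2 A B)
  | or (φ ψ : FO2 A B)
  | ex (v : FOVar) (φ : FO2 A B)
  | all (v : FOVar) (φ : FO2 A B)

namespace FOTerm

/-- The value of a term under the assignment `e`. -/
def eval {A B : Type} (G : OGraph A B) (e : FOVar → G.Dom) : FOTerm → G.Dom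
  | var v => e v
  | o t => G.originFun (t.eval G e)

/-- The variables of a term. -/
def vars : FOTerm → Set FOVar
  | var v => {v}
  | o t => t.vars

/-- Terms as strings. -/
def code : FOTerm → List ℕ
  | var .x => [0]
  | var .y => [1]
  | o t => 2 :: t.code

end FOTerm

namespace FO2

variable {A B : Type}

/-- Truth of a formula in an origin graph under the assignment `e`. -/
def Holds (G : OGraph A B) : FO2 A B → (FOVar → G.Dom) → Prop
  | eq s t, e => s.eval G e = t.eval G e
  | inLabel a t, e => G.InLabel a (t.eval G e)
  | outLabel b t, e => G.OutLabel b (t.eval G e)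
  | leIn s t, e => G.LeIn (s.eval G e) (t.eval G e)
  | leOut s t, e => G.LeOut (s.eval G e) (t.eval G e)
  | succOut s t, e => G.SuccOut (s.eval G e) (t.eval G e)
  | neg φ, e => ¬ φ.Holds G e
  | and φ ψ, e => φ.Holds G e ∧ ψ.Holds G e
  | or φ ψ, e => φ.Holds G e ∨ ψ.Holds G e
  | ex v φ, e => ∃ d : G.Dom, φ.Holds G (Function.update e v d)
  | all v φ, e => ∀ d : G.Dom, φ.Holds G (Function.update e v d)

/-- The free variables of a formula. -/
def freeVars : FO2 A B → Set FOVar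
  | eq s t => s.vars ∪ t.vars
  | inLabel _ t => t.vars
  | outLabel _ t => t.vars
  | leIn s t => s.vars ∪ t.vars
  | leOut s t => s.vars ∪ t.vars
  | succOut s t => s.vars ∪ t.vars
  | neg φ => φ.freeVars
  | and φ ψ => φ.freeVars ∪ ψ.freeVars
  | or φ ψ => φ.freeVars ∪ ψ.freeVars
  | ex v φ => φ.freeVars \ {v}
  | all v φ => φ.freeVars \ {v}

/-- A sentence is a formula without free variables. -/
def IsSentence (φ : FO2 A B) : Prop := φ.freeVars = ∅

/-- `G ⊨ φ`, used for sentences, whose truth does not depend on the assignment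
(`FO2.holds_congr`). -/
def Models (G : OGraph A B) (φ : FO2 A B) : Prop := ∀ e : FOVar → G.Dom, φ.Holds G e

/-- Satisfiability over origin graphs: some origin graph is a model. -/
def Satisfiable (φ : FO2 A B) : Prop := ∃ G : OGraph A B, φ.Models G

/-- Formulas over the alphabets `{0, …, m - 1}` and `{0, …, n - 1}` as strings, in prefix
notation. -/
def code {m n : ℕ} : FO2 (Fin m) (Fin n) → List ℕ
  | eq s t => 0 :: (s.code ++ t.code)
  | inLabel a t => 1 :: a.val :: t.code
  | outLabel b t => 2 :: b.val :: t.code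
  | leIn s t => 3 :: (s.code ++ t.code)
  | leOut s t => 4 :: (s.code ++ t.code)
  | succOut s t => 5 :: (s.code ++ t.code)
  | neg φ => 6 :: φ.code
  | and φ ψ => 7 :: (φ.code ++ ψ.code)
  | or φ ψ => 8 :: (φ.code ++ ψ.code)
  | ex v φ => 9 :: ((FOTerm.var v).code ++ φ.code)
  | all v φ => 10 :: ((FOTerm.var v).code ++ φ.code)

end FO2

theorem FOTerm.eval_congr {A B : Type} (G : OGraph A B) (t : FOTerm) {e e' : FOVar → G.Dom}
    (h : ∀ v ∈ t.vars, e v = e' v) : t.eval G e = t.eval G e' := by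
  induction t with
  | var v => exact h v rfl
  | o t ih => simp only [FOTerm.eval, ih h]

/-- The truth of a formula depends only on the values of its free variables. -/
theorem FO2.holds_congr {A B : Type} (G : OGraph A B) (φ : FO2 A B) {e e' : FOVar → G.Dom}
    (h : ∀ v ∈ φ.freeVars, e v = e' v) : φ.Holds G e ↔ φ.Holds G e' := by
  induction φ generalizing e e' with
  | eq s t | leIn s t | leOut s t | succOut s t =>
    simp only [FO2.Holds, FOTerm.eval_congr G s (fun v hv => h v (Or.inl hv)),
      FOTerm.eval_congr G t (fun v hv => h v (Or.inr hv))]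
  | inLabel a t | outLabel a t => simp only [FO2.Holds, FOTerm.eval_congr G t h]
  | neg φ ih => simp only [FO2.Holds, ih h]
  | and φ ψ ih1 ih2 | or φ ψ ih1 ih2 =>
    simp only [FO2.Holds, ih1 (fun v hv => h v (Or.inl hv)), ih2 (fun v hv => h v (Or.inr hv))]
  | ex v φ ih =>
    refine exists_congr fun d => ih fun w hw => ?_
    by_cases hwv : w = v
    · subst hwv; simp
    · simpa [Function.update_of_ne hwv] using h w ⟨hw, hwv⟩
  | all v φ ih =>
    refine forall_congr' fun d => ih fun w hw => ?_
    by_cases hwv : w = v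
    · subst hwv; simp
    · simpa [Function.update_of_ne hwv] using h w ⟨hw, hwv⟩

theorem FOTerm.code_append_inj (s t : FOTerm) (l l' : List ℕ) (h : s.code ++ l = t.code ++ l') :
    s = t ∧ l = l' := by
  induction s generalizing t with
  | var v => cases v <;> rcases t with (_ | _) | t <;> simp_all [FOTerm.code]
  | o s ih =>
    rcases t with (_ | _) | t
    · simp [FOTerm.code] at h
    · simp [FOTerm.code] at h
    · obtain ⟨rfl, rfl⟩ := ih t (by simpa [FOTerm.code] using h)
      exact ⟨rfl, rfl⟩

theorem FO2.code_append_inj {m n : ℕ} (φ ψ : FO2 (Fin m) (Fin n)) (l l' : List ℕ)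
    (h : φ.code ++ l = ψ.code ++ l') : φ = ψ ∧ l = l' := by
  induction φ generalizing ψ l l' with
  | eq s t | leIn s t | leOut s t | succOut s t =>
    cases ψ <;> simp [FO2.code] at h
    obtain ⟨hs, h⟩ := FOTerm.code_append_inj _ _ _ _ h
    obtain ⟨ht, hl⟩ := FOTerm.code_append_inj _ _ _ _ h
    exact ⟨by rw [hs, ht], hl⟩
  | inLabel a t | outLabel a t =>
    cases ψ <;> simp [FO2.code] at h
    obtain ⟨ha, h⟩ := h
    obtain ⟨rfl, rfl⟩ := FOTerm.code_append_inj _ _ _ _ h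
    rw [Fin.ext ha]
    exact ⟨rfl, rfl⟩
  | neg φ ih =>
    cases ψ <;> simp [FO2.code] at h
    obtain ⟨rfl, rfl⟩ := ih _ _ _ h
    exact ⟨rfl, rfl⟩
  | and φ₁ φ₂ ih1 ih2 | or φ₁ φ₂ ih1 ih2 =>
    cases ψ <;> simp [FO2.code] at h
    obtain ⟨hs, h'⟩ := ih1 _ _ _ h
    obtain ⟨ht, hl⟩ := ih2 _ _ _ h'
    exact ⟨by rw [hs, ht], hl⟩
  | ex v φ ih | all v φ ih =>
    cases ψ <;> simp [FO2.code] at h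
    obtain ⟨hv, h⟩ := FOTerm.code_append_inj _ _ _ _ h
    obtain ⟨rfl, rfl⟩ := ih _ _ _ h
    cases hv
    exact ⟨rfl, rfl⟩

/-- Distinct formulas have distinct codes. -/
theorem FO2.code_injective {m n : ℕ} :
    Function.Injective (FO2.code : FO2 (Fin m) (Fin n) → List ℕ) := fun φ ψ h =>
  (FO2.code_append_inj φ ψ [] [] (by rw [h])).1

/-- The satisfiability problem for fixed alphabets with `m` and `n` letters: the set of (codes of)
sentences that hold in some origin graph over these alphabets. -/
def SatProblemOver (m n : ℕ) : Set (List ℕ) :=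
  {w | ∃ φ : FO2 (Fin m) (Fin n), φ.IsSentence ∧ φ.Satisfiable ∧ w = φ.code}

/-- The satisfiability problem with the alphabets as part of the instance: the set of (codes of)
triples consisting of the numbers `m` and `n` of input and output letters and a sentence over these
alphabets that holds in some origin graph. -/
def SatProblem : Set (List ℕ) :=
  {w | ∃ (m n : ℕ) (φ : FO2 (Fin m) (Fin n)),
    φ.IsSentence ∧ φ.Satisfiable ∧ w = m :: n :: φ.code}

/-!
The halting problem is reduced to satisfiability by way of queue machines.

An origin graph can describe the history of a queue. Let some letters of the output word push a
letter and others pop one. Suppose that the origin map is a strictly increasing bijection from the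
pushing positions to the input positions, and likewise from the popping positions, that the letter
pushed or popped is the letter of the origin, and that a push precedes the pop with the same origin.
Then the `i`-th pop removes the letter of the `i`-th push, and the input word is the sequence of all
letters that pass through the queue (`emptiesQueue_iff_exists_origin`). Each of these conditions
compares only two positions, through `≤in`, `≤out` and `o`, and so it is expressible with two
variables; the successor relation on the output controls the states of the machine and prescribes a
first segment of the output word, which loads the initial queue. Hence the sentence
`FO2.runSentence` is satisfiable exactly if a given queue machine can empty its queue and stop,
starting from given contents.

Queue machines are as strong as stack machines: a tuple of stacks is kept in the queue up to
rotation, each stack behind a separator of its own. The machine rotates the queue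
nondeterministically until the separator of the stack to be accessed comes to the front and moves it to the end; then the
top of that stack is at the front, and letters appended at the end become its new top
(`StackSim.accepts_iff`). Mathlib compiles partial recursive functions to stack machines with
finitely many states. Taking a universal function gives one queue machine for which only the initial
queue varies with the program tested, so the alphabets are fixed; as a formula is coded in prefix
notation, the code of the sentence depends computably on that queue
(`FO2.computable_code_runSentence`).
-/

open Relation Function

/-! ### Queue machines -/

/-- The step relation of a queue machine with control states `Q` and queue alphabet `A`. By a rule
`(p, a, b, q)` the machine passes from state `p` to state `q`, removes the letter `a` (if any) from
the front of the queue and then appends the letter `b` (if any) at its end. -/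
def QueueStep {Q A : Type} (Rule : Q → Option A → Option A → Q → Prop)
    (c d : Q × List A) : Prop :=
  ∃ a b r, Rule c.1 a b d.1 ∧ c.2 = a.toList ++ r ∧ d.2 = r ++ b.toList

/-! ### Simulation of stack machines by queue machines -/

namespace StackSim

open Turing StateTransition

/-- Two words with the same head, which does not occur again, are cyclically equal only if equal.
-/
theorem eq_of_isRotated_cons {α : Type} {a : α} {r₁ r₂ : List α} (h : (a :: r₁) ~r (a :: r₂))
    (ha : a ∉ r₂) : r₁ = r₂ := by
  obtain ⟨n, hn, h⟩ := List.isRotated_iff_mod.1 h.symm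
  rw [List.rotate_eq_drop_append_take hn] at h
  rcases n with _ | n
  · simpa using h.symm
  · simp only [List.drop_succ_cons, List.take_succ_cons] at h
    -- a proper rotation would begin with a letter of `r₂`
    rcases hd : r₂.drop n with _ | ⟨b, l⟩
    · have hr := List.take_append_drop n r₂
      rw [hd, List.append_nil] at hr
      rw [hd, hr] at h
      simpa using h.symm
    · rw [hd] at h
      simp only [List.cons_append, List.cons.injEq] at h
      exact absurd (List.mem_of_mem_drop (i := n) (by rw [hd, h.1]; exact List.mem_cons_self)) ha

variable {K Γ Λ σ : Type}

/-- A stack machine statement over stacks with a common alphabet. -/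
abbrev St (K Γ Λ σ : Type) : Type := TM2.Stmt (fun _ : K => Γ) Λ σ

/-- The stack that the first instruction of a statement works on. -/
def key : St K Γ Λ σ → Option K
  | .push k _ _ => some k
  | .peek k _ _ => some k
  | .pop k _ _ => some k
  | _ => none

/-- Control states of the simulating queue machine: the statement still to be executed, the
internal store, and whether the separator of the stack concerned has just been moved. -/
abbrev Ctl (K Γ Λ σ : Type) : Type := St K Γ Λ σ × σ × Bool

/-- The queue machine simulating the stack machine `M`. It may rotate the queue at will; a stack is
accessed by moving its separator from the front to the end. Having halted, it may empty the queue.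
-/
inductive Rule (M : Λ → St K Γ Λ σ) :
    Ctl K Γ Λ σ → Option (K ⊕ Γ) → Option (K ⊕ Γ) → Ctl K Γ Λ σ → Prop
  | rotate (s v x) : Rule M (s, v, false) (some x) (some x) (s, v, false)
  | access (s v k) (h : key s = some k) :
      Rule M (s, v, false) (some (.inl k)) (some (.inl k)) (s, v, true)
  | push (k f s v) : Rule M (.push k f s, v, true) none (some (.inr (f v))) (s, v, false)
  | peek (k f s v x) :
      Rule M (.peek k f s, v, true) (some x) (some x) (s, f v x.getRight?, false)
  | popEmpty (k f s v j) :
      Rule M (.pop k f s, v, true) (some (.inl j)) (some (.inl j)) (s, f v none, false)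
  | popLetter (k f s v a) :
      Rule M (.pop k f s, v, true) (some (.inr a)) none (s, f v (some a), false)
  | load (f s v) : Rule M (.load f s, v, false) none none (s, f v, false)
  | branch (f s₁ s₂ v) :
      Rule M (.branch f s₁ s₂, v, false) none none (cond (f v) s₁ s₂, v, false)
  | goto (f v) : Rule M (.goto f, v, false) none none (M (f v), v, false)
  | drain (v x) : Rule M (.halt, v, false) (some x) none (.halt, v, false)

/-- The machine can reach an accepting configuration: the program has halted, and the queue is
empty. -/
def Accepts (M : Λ → St K Γ Λ σ) (c : Ctl K Γ Λ σ × List (K ⊕ Γ)) : Prop :=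
  ∃ v, ReflTransGen (QueueStep (Rule M)) c ((.halt, v, false), [])

variable {M : Λ → St K Γ Λ σ}

theorem Accepts.head {p p' : Ctl K Γ Λ σ} {a b : Option (K ⊕ Γ)} {r : List (K ⊕ Γ)}
    (h : Rule M p a b p') (h' : Accepts M (p', r ++ b.toList)) :
    Accepts M (p, a.toList ++ r) := by
  obtain ⟨v, hv⟩ := h'
  exact ⟨v, .head ⟨a, b, r, h, rfl, rfl⟩ hv⟩

theorem Accepts.of_isRotated {s : St K Γ Λ σ} {v : σ} {q q' : List (K ⊕ Γ)} (hq : q ~r q')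
    (h : Accepts M ((s, v, false), q')) : Accepts M ((s, v, false), q) := by
  obtain ⟨n, rfl⟩ := hq
  induction n generalizing q with
  | zero => simpa using h
  | succ n ih =>
    rcases q with _ | ⟨x, q⟩
    · simpa using h
    · exact Accepts.head (r := q) (.rotate s v x) (ih (by simpa using h))

theorem Accepts.of_halt (v : σ) (q : List (K ⊕ Γ)) : Accepts M ((.halt, v, false), q) := by
  induction q with
  | nil => exact ⟨v, .refl⟩
  | cons x q ih => exact Accepts.head (r := q) (.drain v x) (by simpa using ih)

/-- The content of stack `k`, top first, behind a separator that names the stack. -/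
def block (S : K → List Γ) (k : K) : List (K ⊕ Γ) := Sum.inl k :: (S k).map Sum.inr

variable [Fintype K]

/-- The queue `q` represents the stacks `S`: up to rotation, it is the concatenation of the stack
contents, each behind its own separator. -/
def IsQueueOf (q : List (K ⊕ Γ)) (S : K → List Γ) : Prop :=
  q ~r (Finset.univ : Finset K).toList.flatMap (block S)

theorem IsQueueOf.rotated {q q' : List (K ⊕ Γ)} {S : K → List Γ} (h : IsQueueOf q S)
    (h' : q' ~r q) : IsQueueOf q' S := h'.trans h

variable [DecidableEq K]

/-- The part `rest` of the queue that belongs to the other stacks does not depend on the content of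
stack `k`. Behind it, the next letter is always a separator, so an empty stack is recognized. -/
theorem exists_rest (S : K → List Γ) (k : K) : ∃ rest : List (K ⊕ Γ), Sum.inl k ∉ rest ∧
    (∃ j t, rest ++ [Sum.inl k] = Sum.inl j :: t) ∧
    ∀ l, IsQueueOf (Sum.inl k :: (l.map Sum.inr ++ rest)) (update S k l) := by
  obtain ⟨l₁, l₂, hl⟩ := List.append_of_mem (Finset.mem_toList.2 (Finset.mem_univ k))
  have hn := Finset.nodup_toList (Finset.univ : Finset K)
  rw [hl, List.nodup_append] at hn
  have h₁ : k ∉ l₁ := fun h => hn.2.2 k h k List.mem_cons_self rfl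
  have h₂ : k ∉ l₂ := (List.nodup_cons.1 hn.2.1).1
  refine ⟨(l₂ ++ l₁).flatMap (block S), ?_, ?_, fun l => ?_⟩
  · simp only [List.mem_flatMap, block, List.mem_append, List.mem_cons, Sum.inl.injEq,
      List.mem_map, reduceCtorEq, and_false, exists_false, or_false]
    rintro ⟨j, hj | hj, rfl⟩
    · exact h₂ hj
    · exact h₁ hj
  · rcases l₂ ++ l₁ with _ | ⟨j, t⟩
    · exact ⟨k, [], rfl⟩
    · exact ⟨j, _, rfl⟩
  · have hb : ∀ m : List K, k ∉ m → m.flatMap (block (update S k l)) = m.flatMap (block S) := by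
      intro m hm
      refine List.flatMap_congr fun j hj => ?_
      rw [block, block, update_of_ne (by rintro rfl; exact hm hj)]
    have hk : block (update S k l) k = Sum.inl k :: l.map Sum.inr := by simp [block]
    rw [IsQueueOf, hl]
    simp only [List.flatMap_append, List.flatMap_cons, hb _ h₁, hb _ h₂, hk]
    convert List.isRotated_append (l := Sum.inl k :: (l.map Sum.inr ++ l₂.flatMap (block S)))
      (l' := l₁.flatMap (block S)) using 1 <;> simp

theorem IsQueueOf.exists_rotation {q : List (K ⊕ Γ)} {S : K → List Γ} (h : IsQueueOf q S)
    (k : K) : ∃ r, (Sum.inl k :: r) ~r q := by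
  obtain ⟨rest, -, -, hr⟩ := exists_rest S k
  have := hr (S k)
  rw [update_eq_self] at this
  exact ⟨_, this.trans h.symm⟩

/-- Right after the separator of stack `k` has been moved to the end of the queue, stack `k` is at
the front, and letters appended at the end go on top of stack `k`. -/
theorem IsQueueOf.split {r : List (K ⊕ Γ)} {S : K → List Γ} {k : K}
    (h : IsQueueOf (r ++ [Sum.inl k]) S) : ∃ rest, r = (S k).map Sum.inr ++ rest ∧
      (∃ j t, rest ++ [Sum.inl k] = Sum.inl j :: t) ∧
      ∀ l, IsQueueOf (Sum.inl k :: (l.map Sum.inr ++ rest)) (update S k l) := by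
  obtain ⟨rest, h₁, h₂, h₃⟩ := exists_rest S k
  refine ⟨rest, eq_of_isRotated_cons (a := Sum.inl k) ?_ ?_, h₂, h₃⟩
  · have := h₃ (S k)
    rw [update_eq_self] at this
    exact (List.isRotated_concat (Sum.inl k) r).symm.trans (h.trans this.symm)
  · simpa using h₁

theorem Accepts.of_access {s : St K Γ Λ σ} {v : σ} {q : List (K ⊕ Γ)} {S : K → List Γ} {k : K}
    (hs : key s = some k) (hq : IsQueueOf q S)
    (h : ∀ r, IsQueueOf (r ++ [.inl k]) S → Accepts M ((s, v, true), r ++ [.inl k])) :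
    Accepts M ((s, v, false), q) := by
  obtain ⟨r, hr⟩ := hq.exists_rotation k
  refine Accepts.of_isRotated hr.symm (Accepts.head (r := r) (.access s v k hs) (h r ?_))
  exact hq.rotated ((List.isRotated_concat (.inl k) r).trans hr)

/-- Acceptance from every configuration that represents the stack machine configuration `c`. -/
def AcceptsCfg (M : Λ → St K Γ Λ σ) (c : TM2.Cfg (fun _ : K => Γ) Λ σ) : Prop :=
  ∀ l, c.l = some l → ∀ q, IsQueueOf q c.stk → Accepts M ((M l, c.var, false), q)

/-- The queue machine can follow the execution of a statement `s` of the stack machine. -/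
theorem AcceptsCfg.of_stepAux {s : St K Γ Λ σ} {v : σ} {q : List (K ⊕ Γ)} {S : K → List Γ}
    (h : AcceptsCfg M (TM2.stepAux s v S)) (hq : IsQueueOf q S) :
    Accepts M ((s, v, false), q) := by
  induction s generalizing v q S with
  | push k f s ih =>
    refine Accepts.of_access rfl hq fun r hr => Accepts.head (.push k f s v) (ih h ?_)
    obtain ⟨rest, rfl, -, hrest⟩ := hr.split
    refine (hrest (f v :: S k)).rotated ?_
    convert List.isRotated_append (l := (S k).map Sum.inr ++ rest)
      (l' := [Sum.inl k, Sum.inr (f v)]) using 1 <;> simp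
  | peek k f s ih =>
    refine Accepts.of_access rfl hq fun r hr => ?_
    obtain ⟨rest, rfl, ⟨j, t, hj⟩, hrest⟩ := hr.split
    have key : ∀ x r', (S k).map Sum.inr ++ rest ++ [Sum.inl k] = x :: r' →
        x.getRight? = (S k).head? → Accepts M ((.peek k f s, v, true),
          (S k).map Sum.inr ++ rest ++ [Sum.inl k]) := fun x r' hx hx' => by
      rw [hx] at hr ⊢
      refine Accepts.head (r := r') (.peek k f s v x) (ih (by rw [hx']; exact h) ?_)
      exact hr.rotated (List.isRotated_concat x r')
    rcases hS : S k with _ | ⟨a, l⟩ <;> simp only [hS] at key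
    · exact key (.inl j) t (by simpa using hj) rfl
    · exact key (.inr a) _ rfl rfl
  | pop k f s ih =>
    refine Accepts.of_access rfl hq fun r hr => ?_
    obtain ⟨rest, rfl, ⟨j, t, hj⟩, hrest⟩ := hr.split
    rw [TM2.stepAux] at h
    rcases hS : S k with _ | ⟨a, l⟩ <;> rw [hS] at h hr
    · simp only [List.map_nil, List.nil_append, hj] at hr ⊢
      refine Accepts.head (r := t) (.popEmpty k f s v j) (ih h ?_)
      rw [List.tail_nil, ← hS, update_eq_self]
      exact hr.rotated (List.isRotated_concat _ _)
    · refine Accepts.head (r := l.map Sum.inr ++ rest ++ [Sum.inl k])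
        (.popLetter k f s v a) (ih h ?_)
      refine (hrest l).rotated ?_
      convert List.isRotated_concat (Sum.inl k) (l.map Sum.inr ++ rest) using 1; simp
  | load f s ih => exact Accepts.head (r := q) (.load f s v) (ih h (by simpa using hq))
  | branch f s₁ s₂ ih₁ ih₂ =>
    refine Accepts.head (r := q) (.branch f s₁ s₂ v) ?_
    rw [TM2.stepAux] at h
    rw [Option.toList_none, List.append_nil]
    cases hf : f v <;> rw [hf] at h
    · exact ih₂ h hq
    · exact ih₁ h hq
  | goto f =>
    exact Accepts.head (r := q) (.goto f v) (h _ rfl _ (by simpa using hq))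
  | halt => exact Accepts.of_halt v q

theorem AcceptsCfg.of_dom {c : TM2.Cfg (fun _ : K => Γ) Λ σ}
    (h : (eval (TM2.step M) c).Dom) : AcceptsCfg M c := by
  obtain ⟨b, hmem⟩ := Part.dom_iff_mem.1 h
  obtain ⟨hr, hb⟩ := mem_eval.1 hmem
  clear h hmem
  induction hr using ReflTransGen.head_induction_on with
  | refl =>
    intro l hl
    obtain ⟨_, v, S⟩ := b
    cases hl
    cases (hb : some _ = none)
  | head hc _ ih =>
    rename_i c d hd
    obtain ⟨l, v, S⟩ := c
    intro l' hl q hq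
    cases hl
    cases hc
    exact AcceptsCfg.of_stepAux ih hq

/-- The invariant of the converse simulation: the stack machine halts from every configuration that
`c` represents. -/
def HaltsFrom (M : Λ → St K Γ Λ σ) : Ctl K Γ Λ σ × List (K ⊕ Γ) → Prop
  | ((s, v, false), q) => ∀ S, IsQueueOf q S → (eval (TM2.step M) (TM2.stepAux s v S)).Dom
  | ((s, v, true), q) => ∀ S k r, key s = some k → q = r ++ [.inl k] → IsQueueOf q S →
      (eval (TM2.step M) (TM2.stepAux s v S)).Dom

/-- The invariant is carried backwards along any step, also along rotations and accesses that lead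
nowhere; so the nondeterminism of the queue machine does no harm. -/
theorem HaltsFrom.of_step {c d : Ctl K Γ Λ σ × List (K ⊕ Γ)} (hcd : QueueStep (Rule M) c d)
    (h : HaltsFrom M d) : HaltsFrom M c := by
  obtain ⟨p, q⟩ := c
  obtain ⟨p', q'⟩ := d
  obtain ⟨a, b, r, hR, rfl, rfl⟩ := hcd
  cases hR with
  | rotate s v x => exact fun S hS => h S (hS.rotated (List.isRotated_concat x r))
  | access s v k hs => exact fun S hS => h S k r hs rfl (hS.rotated (List.isRotated_concat _ r))
  | push k f s v =>
    rintro S k' r' ⟨⟩ (rfl : r = _) hS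
    refine h (update S k (f v :: S k)) ?_
    obtain ⟨rest, rfl, -, hrest⟩ := hS.split
    refine (hrest (f v :: S k)).rotated ?_
    convert List.isRotated_append (l := (S k).map Sum.inr ++ rest)
      (l' := [Sum.inl k, Sum.inr (f v)]) using 1 <;> simp
  | peek k f s v x =>
    rintro S k' r' ⟨⟩ hr hS
    have hx : x.getRight? = (S k).head? := by
      rw [hr] at hS
      obtain ⟨rest, rfl, ⟨j, t, hj⟩, hrest⟩ := hS.split
      rcases hSk : S k with _ | ⟨a, l⟩ <;> rw [hSk] at hr
      · simp only [List.map_nil, List.nil_append, hj] at hr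
        cases hr
        rfl
      · cases hr
        rfl
    have := h S (hS.rotated (List.isRotated_concat x r))
    rwa [hx] at this
  | popEmpty k f s v j =>
    rintro S k' r' ⟨⟩ hr hS
    have hSk : S k = [] := by
      rw [hr] at hS
      obtain ⟨rest, rfl, -, hrest⟩ := hS.split
      rcases hSk : S k with _ | ⟨a, l⟩ <;> rw [hSk] at hr
      · simp at hr
    have := h S (hS.rotated (List.isRotated_concat _ r))
    rw [TM2.stepAux, hSk, List.tail_nil, ← hSk, update_eq_self, hSk]
    exact this
  | popLetter k f s v a =>
    rintro S k' r' ⟨⟩ hr hS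
    rw [hr] at hS
    obtain ⟨rest, rfl, ⟨j, t, hj⟩, hrest⟩ := hS.split
    rw [TM2.stepAux]
    rcases hSk : S k with _ | ⟨a', l⟩ <;> rw [hSk] at hr
    · simp only [List.map_nil, List.nil_append, hj] at hr
      cases hr
    · cases hr
      refine h _ ((hrest l).rotated ?_)
      convert List.isRotated_concat (Sum.inl k) (l.map Sum.inr ++ rest) using 1; simp
  | load f s v => exact fun S hS => h S (by simpa using hS)
  | branch f s₁ s₂ v =>
    intro S hS
    have := h S (by simpa using hS)
    rw [TM2.stepAux]
    cases hf : f v <;> rw [hf] at this <;> exact this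
  | goto f v =>
    intro S hS
    have := h S (by simpa using hS)
    obtain ⟨b, hb⟩ := Part.dom_iff_mem.1 this
    obtain ⟨hr, hb⟩ := mem_eval.1 hb
    exact Part.dom_iff_mem.2 ⟨b, mem_eval.2 ⟨.head rfl hr, hb⟩⟩
  | drain v x => exact fun S _ => Part.dom_iff_mem.2 ⟨_, mem_eval.2 ⟨.refl, rfl⟩⟩

/-- The queue machine accepts exactly if the stack machine halts. -/
theorem accepts_iff {l : Λ} {v : σ} {S : K → List Γ} {q : List (K ⊕ Γ)} (hq : IsQueueOf q S) :
    Accepts M ((M l, v, false), q) ↔ (eval (TM2.step M) ⟨some l, v, S⟩).Dom := by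
  constructor
  · rintro ⟨v', h⟩
    have : HaltsFrom M ((M l, v, false), q) := by
      generalize ((M l, v, false), q) = c at h
      induction h using ReflTransGen.head_induction_on with
      | refl => exact fun S _ => Part.dom_iff_mem.2 ⟨_, mem_eval.2 ⟨.refl, rfl⟩⟩
      | head h _ ih => exact ih.of_step h
    obtain ⟨b, hb⟩ := Part.dom_iff_mem.1 (this S hq)
    obtain ⟨hr, hb⟩ := mem_eval.1 hb
    exact Part.dom_iff_mem.2 ⟨b, mem_eval.2 ⟨.head rfl hr, hb⟩⟩
  · exact fun h => AcceptsCfg.of_dom h l rfl q hq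

end StackSim

/-! ### Restriction to finitely many states -/

namespace StackSim

open Turing StateTransition

variable {K Γ Λ σ : Type} {M : Λ → St K Γ Λ σ}

/-- The queue machine uses only the finitely many statements that the stack machine can reach. -/
theorem Rule.mem_stmts [Inhabited Λ] {S : Finset Λ} (hS : TM2.Supports M S)
    {p p' : Ctl K Γ Λ σ} {a b : Option (K ⊕ Γ)} (h : Rule M p a b p')
    (hp : some p.1 ∈ TM2.stmts M S) : some p'.1 ∈ TM2.stmts M S := by
  have hsub : ∀ {s t : St K Γ Λ σ}, s ∈ TM2.stmts₁ t → some t ∈ TM2.stmts M S →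
      some s ∈ TM2.stmts M S := TM2.stmts_trans
  cases h with
  | rotate | access | drain => exact hp
  | push | peek | popEmpty | popLetter | load =>
    exact hsub (by simp [TM2.stmts₁, TM2.stmts₁_self]) hp
  | branch f s₁ s₂ v =>
    refine hsub ?_ hp
    cases f v <;> simp [TM2.stmts₁, TM2.stmts₁_self]
  | goto f v =>
    have := TM2.stmts_supportsStmt hS hp v
    simp only [TM2.stmts, Finset.some_mem_insertNone, Finset.mem_biUnion]
    exact ⟨_, this, TM2.stmts₁_self⟩

end StackSim

/-- A queue machine may be restricted to a set of states closed under its rules. -/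
theorem QueueStep.reflTransGen_subtype {Q A : Type} {Rule : Q → Option A → Option A → Q → Prop}
    {T : Set Q} (hT : ∀ p a b q, Rule p a b q → p ∈ T → q ∈ T) {p : T} {l : List A} {q : Q}
    {l' : List A} :
    ReflTransGen (QueueStep Rule) (p.1, l) (q, l') ↔ ∃ hq : q ∈ T, ReflTransGen
      (QueueStep fun (p : T) a b (q : T) => Rule p.1 a b q.1) (p, l) (⟨q, hq⟩, l') := by
  constructor
  · suffices ∀ c, ReflTransGen (QueueStep Rule) (p.1, l) c → ∃ hq : c.1 ∈ T, ReflTransGen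
        (QueueStep fun (p : T) a b (q : T) => Rule p.1 a b q.1) (p, l) (⟨c.1, hq⟩, c.2) from
      fun h => this _ h
    intro c h
    induction h with
    | refl => exact ⟨p.2, .refl⟩
    | tail _ hs ih =>
      obtain ⟨hq, ih⟩ := ih
      obtain ⟨a, b, r, hR, h₁, h₂⟩ := hs
      exact ⟨hT _ _ _ _ hR hq, ih.tail ⟨a, b, r, hR, h₁, h₂⟩⟩
  · rintro ⟨hq, h⟩
    exact ReflTransGen.lift (p := QueueStep Rule) (fun c : T × List A => ((c.1 : Q), c.2))
      (fun _ _ h => h) _ _ h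

/-! ### A universal queue machine -/

open Turing in
instance : Fintype PartrecToTM2.K' :=
  ⟨{.main, .rev, .aux, .stack}, fun k => by cases k <;> simp⟩

theorem trNat_two_pow (k : ℕ) : Turing.PartrecToTM2.trNat (2 ^ k) =
    List.replicate k .bit0 ++ [.bit1] := by
  have h : ∀ k : ℕ, ∃ p : PosNum, ((2 ^ k : ℕ) : Num) = .pos p ∧
      Turing.PartrecToTM2.trPosNum p = List.replicate k .bit0 ++ [.bit1] := by
    intro k
    induction k with
    | zero => exact ⟨1, by simp; rfl, rfl⟩
    | succ k ih =>
      obtain ⟨p, hp, h⟩ := ih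
      refine ⟨p.bit0, ?_, ?_⟩
      · have := Num.ofNat'_bit false (2 ^ k)
        rw [pow_succ, mul_comm, ← Nat.bit_false_apply, ← Num.ofNat'_eq, Num.ofNat'_bit,
          Num.ofNat'_eq, hp]
        rfl
      · rw [Turing.PartrecToTM2.trPosNum, h]
        rfl
  obtain ⟨p, hp, h⟩ := h k
  rw [Turing.PartrecToTM2.trNat, hp, Turing.PartrecToTM2.trNum, h]

/-- The `k`-th program in the enumeration of all programs halts on input `0`. -/
def HaltsOnZero (k : ℕ) : Prop :=
  (Nat.Partrec.Code.eval (Denumerable.ofNat Nat.Partrec.Code k) 0).Dom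

theorem not_computablePred_haltsOnZero : ¬ ComputablePred HaltsOnZero := by
  rintro ⟨_, h⟩
  refine ComputablePred.halting_problem 0 ⟨fun c => decidable_of_iff
    (HaltsOnZero (Encodable.encode c)) (by simp [HaltsOnZero]), ?_⟩
  exact (h.comp Computable.encode).of_eq fun c => by
    rw [decide_eq_decide, HaltsOnZero, Denumerable.ofNat_encode]

/-- A universal program: run on `2 ^ k`, it halts exactly if the `k`-th program halts on `0`.
Powers of two are used because the binary representation of `2 ^ k` is easily computed. -/
theorem exists_universal : ∃ c : Turing.ToPartrec.Code, ∀ k : ℕ,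
    (c.eval [2 ^ k]).Dom ↔ HaltsOnZero k := by
  -- the search for the exponent need not terminate unless `n` is a power of two
  let f : ℕ →. ℕ := fun n => (Nat.rfind fun k => Part.some (decide (2 ^ k = n))).bind fun k =>
    Nat.Partrec.Code.eval (Denumerable.ofNat Nat.Partrec.Code k) 0
  have hpow : Primrec fun k : ℕ => 2 ^ k :=
    (Primrec.nat_rec₁ (f := fun _ m => 2 * m) 1
      (Primrec.nat_mul.comp (Primrec.const 2) Primrec.snd)).of_eq fun k => by
        induction k with
        | zero => rfl
        | succ k ih => exact (congrArg (2 * ·) ih).trans (by ring)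
  have hf : Partrec f := by
    refine Partrec.bind (Partrec.rfind ?_) ?_
    · have : Primrec₂ fun n k : ℕ => decide (2 ^ k = n) :=
        (Primrec.eq.comp (hpow.comp Primrec.snd) Primrec.fst).decide
      exact this.to_comp.partrec₂
    · exact Nat.Partrec.Code.eval_part.comp
        ((Computable.ofNat Nat.Partrec.Code).comp Computable.snd) (Computable.const 0)
  obtain ⟨c, hc⟩ := Turing.ToPartrec.Code.exists_code (Nat.Partrec'.part_iff₁.2 hf)
  refine ⟨c, fun k => ?_⟩
  have h := hc (2 ^ k ::ᵥ List.Vector.nil)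
  have hr : (Nat.rfind fun j => Part.some (decide (2 ^ j = 2 ^ k))) = Part.some k := by
    refine Part.eq_some_iff.2 (Nat.mem_rfind.2 ⟨by simp, fun {j} hj => ?_⟩)
    simp [hj.ne]
  have h' : c.eval [2 ^ k] = pure <$> f (2 ^ k) := h
  rw [h']
  simp only [f, hr, Part.bind_some]
  exact Iff.rfl

open Turing PartrecToTM2 StackSim in
/-- There is a queue machine with finitely many states and letters whose acceptance problem is the
halting problem, already for initial contents of the queue that depend on the instance only through
the number of repetitions of one letter. -/
theorem exists_universal_queueMachine : ∃ (Q A : Type) (_ : Fintype Q) (_ : Fintype A)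
    (Rule : Q → Option A → Option A → Q → Prop) (q₀ : Q) (F : Set Q) (l₁ l₂ : List A) (a : A),
    l₁ ≠ [] ∧ ∀ k : ℕ, HaltsOnZero k ↔ ∃ q ∈ F,
      ReflTransGen (QueueStep Rule) (q₀, l₁ ++ List.replicate k a ++ l₂) (q, []) := by
  classical
  obtain ⟨c, hc⟩ := exists_universal
  let S := codeSupp c .halt
  let _ : Inhabited Λ' := ⟨trNormal c .halt⟩
  have hS : TM2.Supports tr S := tr_supports c .halt
  let T : Set (Ctl K' Γ' Λ' (Option Γ')) := {p | some p.1 ∈ TM2.stmts tr S}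
  have hT : ∀ p a b q, Rule tr p a b q → p ∈ T → q ∈ T := fun p a b q h => h.mem_stmts hS
  have hfin : T.Finite := by
    have : {s | some s ∈ TM2.stmts tr S}.Finite :=
      (TM2.stmts tr S).finite_toSet.preimage (Option.some_injective _).injOn
    exact (this.prod Set.finite_univ).subset fun p hp => ⟨hp, trivial⟩
  have h₀ : ((tr (trNormal c .halt), none, false) : Ctl K' Γ' Λ' (Option Γ')) ∈ T := by
    simp only [T, Set.mem_ofPred_eq, TM2.stmts, Finset.some_mem_insertNone, Finset.mem_biUnion]
    exact ⟨_, hS.1, TM2.stmts₁_self⟩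
  obtain ⟨rest, -, -, hrest⟩ := exists_rest (K'.elim [] [] [] []) K'.main
  refine ⟨T, K' ⊕ Γ', hfin.fintype, inferInstance, fun p a b q => Rule tr p.1 a b q.1, ⟨_, h₀⟩,
    {p | ∃ v, p.1 = (.halt, v, false)}, [.inl .main],
    [.inr .bit1, .inr .cons] ++ rest, .inr .bit0, by simp, fun k => ?_⟩
  have hq := hrest (trList [2 ^ k])
  rw [show update (K'.elim [] [] [] []) K'.main (trList [2 ^ k]) =
    K'.elim (trList [2 ^ k]) [] [] [] by simp] at hq
  have := accepts_iff (M := tr) (l := trNormal c .halt) (v := none) hq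
  rw [← hc]
  have hd : (c.eval [2 ^ k]).Dom ↔ (StateTransition.eval (TM2.step tr) (init c [2 ^ k])).Dom := by
    rw [tr_eval]
    exact Iff.rfl
  rw [hd]
  refine this.symm.trans ?_
  have hl : (Sum.inl K'.main :: ((trList [2 ^ k]).map Sum.inr ++ rest) : List (K' ⊕ Γ')) =
      [.inl .main] ++ List.replicate k (.inr .bit0) ++ ([.inr .bit1, .inr .cons] ++ rest) := by
    simp [trNat_two_pow]
  rw [hl]
  constructor
  · rintro ⟨v, hv⟩
    obtain ⟨hm, h⟩ := (QueueStep.reflTransGen_subtype hT (p := ⟨_, h₀⟩)).1 hv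
    exact ⟨_, ⟨v, rfl⟩, h⟩
  · rintro ⟨⟨_, hm⟩, ⟨v, rfl⟩, h⟩
    exact ⟨v, (QueueStep.reflTransGen_subtype hT (p := ⟨_, h₀⟩)).2 ⟨hm, h⟩⟩

/-! ### Words operating on a queue, and origin maps -/

section QueueWords

variable {A B : Type}

/-- Reading a word `γ` whose letters append to a queue (`push`) or remove from its front (`pop`),
starting with the queue `l`, leads to the empty queue: the letters removed are those of `l` followed
by those appended, and no letter is removed before it has been appended. -/
def EmptiesQueue (push pop : B → Option A) (l : List A) (γ : List B) : Prop :=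
  l ++ γ.filterMap push = γ.filterMap pop ∧
    ∀ δ, δ <+: γ → (δ.filterMap pop).length ≤ l.length + (δ.filterMap push).length

theorem emptiesQueue_nil {push pop : B → Option A} {l : List A} :
    EmptiesQueue push pop l [] ↔ l = [] := by
  simp [EmptiesQueue]

theorem emptiesQueue_cons {push pop : B → Option A} {l : List A} {b : B} {γ : List B}
    (hb : push b = none ∨ pop b = none) : EmptiesQueue push pop l (b :: γ) ↔
      ∃ r, l = (pop b).toList ++ r ∧ EmptiesQueue push pop (r ++ (push b).toList) γ := by
  have hf : ∀ (f : B → Option A) (δ : List B),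
      (b :: δ).filterMap f = (f b).toList ++ δ.filterMap f := by
    intro f δ
    cases h : f b <;> simp [h]
  constructor
  · rintro ⟨h₁, h₂⟩
    have hl : ((pop b).toList).length ≤ l.length := by
      have := h₂ [b] (by simp)
      rcases hb with hb | hb
      · simpa [hf, hb] using this
      · simp [hb]
    rw [hf, hf] at h₁
    obtain ⟨r, rfl⟩ : (pop b).toList <+: l :=
      List.prefix_of_prefix_length_le ⟨_, rfl⟩ ⟨_, h₁⟩ hl
    refine ⟨r, rfl, ?_, fun δ hδ => ?_⟩
    · simpa using h₁
    · have := h₂ (b :: δ) (by simpa using hδ)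
      simp only [hf, List.length_append] at this ⊢
      omega
  · rintro ⟨r, rfl, h₁, h₂⟩
    refine ⟨by simpa [hf] using h₁, fun δ hδ => ?_⟩
    rcases List.prefix_cons_iff.1 hδ with rfl | ⟨δ, rfl, hδ'⟩
    · simp
    · have := h₂ δ hδ'
      simp only [hf, List.length_append] at this ⊢
      omega

/-- The number of letters among the first `t` letters of `l` on which `f` is defined. -/
def numBefore (f : B → Option A) (l : List B) (t : ℕ) : ℕ := ((l.take t).filterMap f).length

theorem numBefore_mono (f : B → Option A) (l : List B) : Monotone (numBefore f l) :=
  fun _ _ h => ((List.take_prefix_take_left h).sublist.filterMap f).length_le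

theorem numBefore_succ (f : B → Option A) {l : List B} {t : ℕ} (ht : t < l.length)
    (h : (f l[t]).isSome) : numBefore f l (t + 1) = numBefore f l t + 1 := by
  obtain ⟨a, ha⟩ := Option.isSome_iff_exists.1 h
  rw [numBefore, List.take_add_one, List.getElem?_eq_getElem ht]
  simp only [List.filterMap_append, List.length_append, Option.toList_some,
    List.filterMap_cons_some ha, List.filterMap_nil, List.length_singleton, numBefore]

theorem numBefore_lt_numBefore (f : B → Option A) {l : List B} {s t : ℕ} (hs : s < l.length)
    (h : (f l[s]).isSome) (hst : s < t) : numBefore f l s < numBefore f l t := by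
  have := numBefore_mono f l (show s + 1 ≤ t from hst)
  rw [numBefore_succ f hs h] at this
  exact this

theorem getElem?_numBefore (f : B → Option A) {l : List B} {t : ℕ} (ht : t < l.length) {a : A}
    (ha : f l[t] = some a) : (l.filterMap f)[numBefore f l t]? = some a := by
  conv_lhs => rw [← List.take_append_drop t l, List.filterMap_append, numBefore]
  rw [List.take_append_drop, List.getElem?_append_right le_rfl, List.drop_eq_getElem_cons ht,
    List.filterMap_cons_some ha, Nat.sub_self, List.getElem?_cons_zero]

theorem numBefore_lt_length (f : B → Option A) {l : List B} {t : ℕ} (ht : t < l.length)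
    (h : (f l[t]).isSome) : numBefore f l t < (l.filterMap f).length := by
  have := numBefore_lt_numBefore f ht h ht
  rwa [numBefore, numBefore, List.take_length] at this

theorem exists_numBefore_eq (f : B → Option A) (l : List B) {p : ℕ}
    (hp : p < (l.filterMap f).length) :
    ∃ (t : ℕ) (ht : t < l.length), (f l[t]).isSome ∧ numBefore f l t = p := by
  induction l generalizing p with
  | nil => simp at hp
  | cons b l ih =>
    cases hb : f b with
    | none =>
      obtain ⟨t, ht, h₁, h₂⟩ := ih (by simpa [hb] using hp)
      exact ⟨t + 1, by simpa using ht, by simpa using h₁, by simpa [numBefore, hb] using h₂⟩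
    | some a =>
      rcases p with _ | p
      · exact ⟨0, by simp, by simp [hb], by simp [numBefore]⟩
      · obtain ⟨t, ht, h₁, h₂⟩ := ih (p := p) (by simpa [hb] using hp)
        exact ⟨t + 1, by simpa using ht, by simpa using h₁, by simpa [numBefore, hb] using h₂⟩

theorem numBefore_eq_card (f : B → Option A) (l : List B) (t : ℕ) :
    numBefore f l t = ((Finset.range t).filter fun i => ((l[i]?).bind f).isSome).card := by
  induction t with
  | zero => simp [numBefore]
  | succ t ih =>
    rw [Finset.range_add_one, Finset.filter_insert, numBefore, List.take_add_one,
      List.filterMap_append, List.length_append]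
    rw [numBefore] at ih
    rw [ih]
    rcases h : l[t]? with _ | b
    · simp
    · rcases hb : f b with _ | a
      · simp [hb]
      · simp [hb]

/-- `o` maps the letters of `l` on which `f` is defined bijectively and in order to the word `u`, in
such a way that `f` gives the letter of the image. -/
structure Spells (f : B → Option A) (l : List B) (u : List A) (o : Fin l.length → Fin u.length) :
    Prop where
  strictMono : ∀ i j, (f (l.get i)).isSome → (f (l.get j)).isSome → i < j → o i < o j
  surj : ∀ p, ∃ i, (f (l.get i)).isSome ∧ o i = p
  label : ∀ i, (f (l.get i)).isSome → f (l.get i) = some (u.get (o i))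

theorem Spells.filterMap_eq {f : B → Option A} {l : List B} {u : List A}
    {o : Fin l.length → Fin u.length} (h : Spells f l u o) : l.filterMap f = u := by
  -- both sides are strictly increasing and have the same members
  have h₁ : ((List.finRange l.length).filter fun i => (f (l.get i)).isSome).map o =
      List.finRange u.length := by
    have hs : List.Pairwise (· < ·)
        (((List.finRange l.length).filter fun i => (f (l.get i)).isSome).map o) := by
      rw [List.pairwise_map]
      have := (List.pairwise_lt_finRange l.length).filter fun i => (f (l.get i)).isSome
      refine this.imp_of_mem fun {i j} hi hj hij => ?_
      simp only [List.mem_filter] at hi hj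
      exact h.strictMono i j hi.2 hj.2 hij
    have hs' := List.pairwise_lt_finRange u.length
    refine List.Perm.eq_of_pairwise (le := (· < ·)) (fun a b _ _ h₁ h₂ => absurd h₁ h₂.asymm) hs hs' ?_
    refine (List.perm_ext_iff_of_nodup (hs.imp fun h => h.ne) (hs'.imp fun h => h.ne)).2
      fun p => ?_
    obtain ⟨i, hi, rfl⟩ := h.surj p
    simp only [List.mem_finRange, iff_true, List.mem_map, List.mem_filter, true_and]
    exact ⟨i, hi, rfl⟩
  have h₂ : ∀ m : List (Fin l.length), m.filterMap (fun i => f (l.get i)) =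
      (m.filter fun i => (f (l.get i)).isSome).map fun i => u.get (o i) := by
    intro m
    induction m with
    | nil => rfl
    | cons i m ih =>
      by_cases hi : (f (l.get i)).isSome
      · rw [List.filterMap_cons_some (f := fun i => f (l.get i)) (h.label i hi),
          List.filter_cons_of_pos (p := fun i => (f (l.get i)).isSome) hi, List.map_cons, ih]
      · rw [List.filterMap_cons_none (f := fun i => f (l.get i)) (by simpa using hi),
          List.filter_cons_of_neg (p := fun i => (f (l.get i)).isSome) hi, ih]
  calc l.filterMap f = ((List.finRange l.length).map l.get).filterMap f := by
        rw [List.map_get_finRange]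
    _ = (List.finRange l.length).filterMap fun i => f (l.get i) := by
        rw [List.filterMap_map]; rfl
    _ = (((List.finRange l.length).filter fun i => (f (l.get i)).isSome).map o).map u.get := by
        rw [h₂, List.map_map]; rfl
    _ = u := by rw [h₁, List.map_get_finRange]

theorem Spells.injOn {f : B → Option A} {l : List B} {u : List A}
    {o : Fin l.length → Fin u.length} (h : Spells f l u o) {i j : Fin l.length}
    (hi : (f (l.get i)).isSome) (hj : (f (l.get j)).isSome) (hij : o i = o j) : i = j := by
  rcases lt_trichotomy i j with hlt | rfl | hlt
  · exact absurd hij (h.strictMono i j hi hj hlt).ne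
  · rfl
  · exact absurd hij (h.strictMono j i hj hi hlt).ne'

/-- A word empties the initially empty queue if and only if there is an origin map under which both
its pushed letters and its popped letters spell the same word, no letter being popped before it is
pushed. -/
theorem emptiesQueue_iff_exists_origin {push pop : B → Option A}
    (hpp : ∀ b, push b = none ∨ pop b = none) (β : List B) (hne : β.filterMap push ≠ []) :
    EmptiesQueue push pop [] β ↔ ∃ (u : List A) (_ : u ≠ []) (o : Fin β.length → Fin u.length),
      Spells push β u o ∧ Spells pop β u o ∧ ∀ i j, (push (β.get i)).isSome →
        (pop (β.get j)).isSome → o i = o j → i ≤ j := by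
  have disj : ∀ b, (push b).isSome → ¬ (pop b).isSome := fun b h h' => by
    rcases hpp b with hb | hb
    · rw [hb] at h; cases h
    · rw [hb] at h'; cases h'
  constructor
  · rintro ⟨h₁, h₂⟩
    rw [List.nil_append] at h₁
    have hlen : ∀ t, numBefore pop β t ≤ numBefore push β t := fun t => by
      simpa [numBefore] using h₂ _ (List.take_prefix t β)
    have hpos : 0 < (β.filterMap push).length := List.length_pos_iff.2 hne
    -- the origin of the `i`-th push, and of the `i`-th pop, is the `i`-th input position; letters
    -- that do neither may have any origin
    let o : Fin β.length → Fin (β.filterMap push).length := fun i =>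
      if h : (push (β.get i)).isSome then ⟨_, numBefore_lt_length push i.2 h⟩
      else if h' : (pop (β.get i)).isSome then ⟨_, h₁ ▸ numBefore_lt_length pop i.2 h'⟩
      else ⟨0, hpos⟩
    have ho₁ : ∀ i, (push (β.get i)).isSome → (o i : ℕ) = numBefore push β i := fun i h => by
      simp only [o, dif_pos h]
    have ho₂ : ∀ i, (pop (β.get i)).isSome → (o i : ℕ) = numBefore pop β i := fun i h => by
      simp only [o, dif_neg fun h' => disj _ h' h, dif_pos h]
    have spells : ∀ f : B → Option A, β.filterMap f = β.filterMap push →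
        (∀ i, (f (β.get i)).isSome → (o i : ℕ) = numBefore f β i) →
        Spells f β (β.filterMap push) o := fun f hf ho => by
      refine ⟨fun i j hi hj hij => ?_, fun p => ?_, fun i hi => ?_⟩
      · rw [Fin.lt_def, ho i hi, ho j hj]
        exact numBefore_lt_numBefore f i.2 hi hij
      · obtain ⟨t, ht, h, hp⟩ := exists_numBefore_eq f β (p := p) (hf.symm ▸ p.2)
        exact ⟨⟨t, ht⟩, h, Fin.ext ((ho ⟨t, ht⟩ h).trans hp)⟩
      · obtain ⟨a, ha⟩ := Option.isSome_iff_exists.1 hi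
        have := getElem?_numBefore f i.2 ha
        rw [hf, ← ho i hi, List.getElem?_eq_getElem (o i).2] at this
        rw [ha]
        exact this.symm
    refine ⟨_, hne, o, spells push rfl ho₁, spells pop h₁.symm ho₂, fun i j hi hj hij => ?_⟩
    by_contra! hji
    have e₁ := ho₁ i hi
    have e₂ := ho₂ j hj
    have e₃ := numBefore_succ pop j.2 hj
    have e₄ := hlen (j + 1)
    have e₅ := numBefore_mono push β (show (j : ℕ) + 1 ≤ i from hji)
    rw [hij] at e₁
    omega
  · rintro ⟨u, -, o, h₁, h₂, h₃⟩
    refine ⟨by rw [List.nil_append, h₁.filterMap_eq, h₂.filterMap_eq], fun δ hδ => ?_⟩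
    have hδ' := List.prefix_iff_eq_take.1 hδ
    have key : numBefore pop β δ.length ≤ numBefore push β δ.length := by
      rw [numBefore_eq_card, numBefore_eq_card]
      have hmem : ∀ (f : B → Option A) (j : ℕ), ((β[j]?).bind f).isSome → ∃ h : j < β.length,
          (f (β.get ⟨j, h⟩)).isSome := fun f j h => by
        by_cases hj : j < β.length
        · exact ⟨hj, by simpa [List.getElem?_eq_getElem hj] using h⟩
        · simp [List.getElem?_eq_none (not_lt.1 hj)] at h
      -- each pop is sent to the push with the same origin
      have hex : ∀ j : Fin β.length, ∃ i : Fin β.length, (push (β.get i)).isSome ∧ o i = o j :=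
        fun j => h₁.surj (o j)
      choose g hg₁ hg₂ using hex
      refine Finset.card_le_card_of_injOn
        (fun j => if h : j < β.length then (g ⟨j, h⟩ : ℕ) else 0) (fun j hj => ?_)
        fun j hj j' hj' hjj => ?_
      · simp only [Finset.coe_filter, Finset.mem_range, Set.mem_ofPred_eq] at hj ⊢
        obtain ⟨hjl, hjs⟩ := hmem pop j hj.2
        simp only [dif_pos hjl]
        refine ⟨lt_of_le_of_lt (h₃ _ _ (hg₁ ⟨j, hjl⟩) hjs (hg₂ _)) hj.1, ?_⟩
        rw [List.getElem?_eq_getElem (g ⟨j, hjl⟩).2]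
        exact hg₁ ⟨j, hjl⟩
      · simp only [Finset.coe_filter, Finset.mem_range, Set.mem_ofPred_eq] at hj hj'
        obtain ⟨hjl, hjs⟩ := hmem pop j hj.2
        obtain ⟨hjl', hjs'⟩ := hmem pop j' hj'.2
        simp only [dif_pos hjl, dif_pos hjl'] at hjj
        have := hg₂ ⟨j, hjl⟩
        rw [Fin.ext hjj, hg₂] at this
        exact congrArg Fin.val (h₂.injOn hjs' hjs this).symm
    rw [numBefore, ← hδ', numBefore, ← hδ'] at key
    simpa using key

end QueueWords

/-! ### Queue systems and their sentences -/

/-- A finite description of a set of words over `B` that operate on a queue over `A`: the letter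
that each letter of `B` pushes or pops, the pairs of consecutive letters that are permitted, the
letters that may follow a prescribed initial word, and the letters that may come last. -/
structure QueueSystem (A B : Type) where
  push : B → Option A
  pop : B → Option A
  next : B → B → Prop
  mayFollow : B → Prop
  mayEnd : B → Prop

/-- The words described by a queue system, with prescribed proper prefix `w`. -/
def QueueSystem.IsRun {A B : Type} (S : QueueSystem A B) (w β : List B) : Prop :=
  (∃ c γ, β = w ++ c :: γ ∧ S.mayFollow c) ∧ β.IsChain S.next ∧
    (∀ b ∈ β.getLast?, S.mayEnd b) ∧ EmptiesQueue S.push S.pop [] β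

namespace FO2

variable {A B : Type}

/-- The variable `x` as a term. -/
abbrev tx : FOTerm := .var .x

/-- The variable `y` as a term. -/
abbrev ty : FOTerm := .var .y

/-- Implication. -/
def imp (φ ψ : FO2 A B) : FO2 A B := or (neg φ) ψ

/-- The disjunction of the formulas `f i` for `i` in a list. -/
def bigOr {ι : Type} (f : ι → FO2 A B) : List ι → FO2 A B
  | [] => neg (eq tx tx)
  | i :: l => or (f i) (bigOr f l)

open Classical in
/-- The term `t` denotes an output position whose letter has the property `P`. -/
noncomputable def outIn [Fintype B] (P : B → Prop) (t : FOTerm) : FO2 A B :=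
  bigOr (fun b => outLabel b t) (Finset.univ.filter P).toList

/-- Consecutive letters of the output word are permitted to be adjacent, and the letter of an output
position without a successor may come last. -/
noncomputable def localRule [Fintype B] (S : QueueSystem A B) : FO2 A B :=
  and
    (all .x (all .y (imp (succOut tx ty)
      (bigOr (fun b => and (outLabel b tx) (outIn (S.next b) ty)) Finset.univ.toList))))
    (all .x (imp (outIn (fun _ => True) tx) (or (ex .y (succOut tx ty)) (outIn S.mayEnd tx))))

/-- The origin map is a strictly monotone surjection from the positions whose letters are in the
domain of `f` to the input positions, and `f` gives the letters of the origins. -/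
noncomputable def spelling [Fintype A] [Fintype B] (f : B → Option A) : FO2 A B :=
  and
    (all .x (all .y (imp
      (and (and (outIn (fun b => (f b).isSome) tx) (outIn (fun b => (f b).isSome) ty))
        (and (leOut tx ty) (neg (eq tx ty))))
      (and (leIn (.o tx) (.o ty)) (neg (eq (.o tx) (.o ty)))))))
    (and
      (all .x (imp (eq (.o tx) tx)
        (ex .y (and (outIn (fun b => (f b).isSome) ty) (eq (.o ty) tx)))))
      (all .x (imp (outIn (fun b => (f b).isSome) tx)
        (bigOr (fun a => and (outIn (fun b => f b = some a) tx) (inLabel a (.o tx)))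
          Finset.univ.toList))))

/-- A push precedes every pop with the same origin. -/
noncomputable def pushFirst [Fintype B] (S : QueueSystem A B) : FO2 A B :=
  all .x (all .y (imp
    (and (and (outIn (fun b => (S.push b).isSome) tx) (outIn (fun b => (S.pop b).isSome) ty))
      (eq (.o tx) (.o ty)))
    (leOut tx ty)))

/-- The word `w` followed by a letter that satisfies `P` can be read from `x` on. The position
next to `x` is found as `y` and then renamed to `x`. -/
noncomputable def startsWith [Fintype B] (P : B → Prop) : List B → FO2 A B
  | [] => outIn P tx
  | b :: w => and (outLabel b tx) (ex .y (and (succOut tx ty)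
      (ex .x (and (eq tx ty) (startsWith P w)))))

/-- The sentence saying that the output word is a run of `S` with initial word `w`. The two outer
quantifiers bind variables that are not free, which makes it evident that this is a sentence. -/
noncomputable def runSentence [Fintype A] [Fintype B] (S : QueueSystem A B) (w : List B) :
    FO2 A B :=
  ex .x (ex .y (and
    (and (and (localRule S) (pushFirst S)) (and (spelling S.push) (spelling S.pop)))
    (ex .x (and (neg (ex .y (succOut ty tx))) (startsWith S.mayFollow w)))))

theorem isSentence_runSentence [Fintype A] [Fintype B] (S : QueueSystem A B) (w : List B) :
    (runSentence S w).IsSentence := by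
  refine Set.eq_empty_iff_forall_notMem.2 fun v hv => ?_
  obtain ⟨⟨-, hy⟩, hx⟩ := hv
  cases v
  · exact hx rfl
  · exact hy rfl

variable {G : OGraph A B} {e : FOVar → G.Dom}

theorem holds_imp {φ ψ : FO2 A B} : (imp φ ψ).Holds G e ↔ (φ.Holds G e → ψ.Holds G e) := by
  simp only [imp, Holds, imp_iff_not_or]

theorem holds_bigOr {ι : Type} {f : ι → FO2 A B} {l : List ι} :
    (bigOr f l).Holds G e ↔ ∃ i ∈ l, (f i).Holds G e := by
  induction l with
  | nil => simp [bigOr, Holds]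
  | cons i l ih => simp [bigOr, Holds, ih]

theorem holds_outIn [Fintype B] {P : B → Prop} {t : FOTerm} :
    (outIn P t).Holds G e ↔ ∃ j, t.eval G e = .inr j ∧ P (G.output.get j) := by
  simp only [outIn, holds_bigOr, Finset.mem_toList, Finset.mem_filter, Finset.mem_univ, true_and,
    Holds]
  constructor
  · rintro ⟨b, hb, h⟩
    rcases ht : t.eval G e with i | j <;> rw [ht] at h
    · exact h.elim
    · exact ⟨j, rfl, by rwa [show G.output.get j = b from h]⟩
  · rintro ⟨j, ht, h⟩
    exact ⟨_, h, by rw [ht]; rfl⟩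

open Function in
theorem holds_localRule [Fintype B] {S : QueueSystem A B} : (localRule S).Holds G e ↔
    G.output.IsChain S.next ∧ ∀ b ∈ G.output.getLast?, S.mayEnd b := by
  simp only [localRule, Holds, holds_imp, holds_bigOr, holds_outIn, FOTerm.eval, update_self, ne_eq,
    reduceCtorEq, not_false_eq_true, update_of_ne, Finset.mem_toList, Finset.mem_univ, true_and,
    and_true]
  refine and_congr ?_ ?_
  · rw [List.isChain_iff_getElem]
    constructor
    · intro h i hi
      obtain ⟨b, hb, j, hj, hn⟩ := h (.inr ⟨i, by omega⟩) (.inr ⟨i + 1, hi⟩) rfl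
      cases hj
      cases (hb : G.output.get _ = b)
      exact hn
    · intro h x y hxy
      rcases x with x | x <;> rcases y with y | y <;> try exact hxy.elim
      have hy : y.val = x.val + 1 := hxy
      refine ⟨_, rfl, y, rfl, ?_⟩
      have := h x.val (hy ▸ y.2)
      simpa [hy] using this
  · constructor
    · intro h b hb
      rcases hl : G.output.length with _ | n
      · rw [List.length_eq_zero_iff] at hl
        rw [hl] at hb
        cases hb
      · rcases h (.inr ⟨n, by omega⟩) ⟨⟨n, by omega⟩, rfl⟩ with ⟨y, hy⟩ | ⟨j, hj, hs⟩
        · rcases y with y | y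
          · exact hy.elim
          · have : y.val = n + 1 := hy
            omega
        · cases hj
          rw [List.getLast?_eq_getElem?, hl, Nat.add_sub_cancel, List.getElem?_eq_getElem (by omega)]
            at hb
          cases hb
          exact hs
    · rintro h d ⟨j, rfl⟩
      by_cases hj : j.val + 1 < G.output.length
      · exact Or.inl ⟨.inr ⟨j + 1, hj⟩, rfl⟩
      · refine Or.inr ⟨j, rfl, h _ ?_⟩
        rw [List.getLast?_eq_getElem?, show G.output.length - 1 = j.val by omega,
          List.getElem?_eq_getElem j.2]
        rfl

open Function in
theorem holds_spelling [Fintype A] [Fintype B] {f : B → Option A} :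
    (spelling f).Holds G e ↔ Spells f G.output G.input G.origin := by
  simp only [spelling, Holds, holds_imp, holds_bigOr, holds_outIn, FOTerm.eval, update_self, ne_eq,
    reduceCtorEq, not_false_eq_true, update_of_ne, Finset.mem_toList, Finset.mem_univ, true_and]
  constructor
  · rintro ⟨h₁, h₂, h₃⟩
    refine ⟨fun i j hi hj hij => ?_, fun p => ?_, fun i hi => ?_⟩
    · obtain ⟨hle, hne⟩ := h₁ (.inr i) (.inr j)
        ⟨⟨⟨i, rfl, hi⟩, ⟨j, rfl, hj⟩⟩, hij.le, fun h => hij.ne (Sum.inr.inj h)⟩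
      exact lt_of_le_of_ne hle fun h => hne (congrArg Sum.inl h)
    · obtain ⟨d, ⟨j, rfl, hj⟩, hd⟩ := h₂ (.inl p) rfl
      exact ⟨j, hj, Sum.inl.inj hd⟩
    · obtain ⟨a, ⟨j, hj, hfa⟩, ha⟩ := h₃ (.inr i) ⟨i, rfl, hi⟩
      cases hj
      rw [hfa]
      exact congrArg some (show G.input.get _ = a from ha).symm
  · rintro ⟨h₁, h₂, h₃⟩
    refine ⟨?_, ?_, ?_⟩
    · rintro _ _ ⟨⟨⟨i, rfl, hi⟩, ⟨j, rfl, hj⟩⟩, hle, hne⟩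
      have := h₁ i j hi hj (lt_of_le_of_ne hle fun h => hne (congrArg Sum.inr h))
      exact ⟨this.le, fun h => this.ne (Sum.inl.inj h)⟩
    · rintro (p | j) h
      · obtain ⟨j, hj, rfl⟩ := h₂ p
        exact ⟨.inr j, ⟨j, rfl, hj⟩, rfl⟩
      · cases h
    · rintro _ ⟨i, rfl, hi⟩
      exact ⟨_, ⟨i, rfl, h₃ i hi⟩, rfl⟩

open Function in
theorem holds_pushFirst [Fintype B] {S : QueueSystem A B} : (pushFirst S).Holds G e ↔
    ∀ i j, (S.push (G.output.get i)).isSome → (S.pop (G.output.get j)).isSome →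
      G.origin i = G.origin j → i ≤ j := by
  simp only [pushFirst, Holds, holds_imp, holds_outIn, FOTerm.eval, update_self, ne_eq,
    reduceCtorEq, not_false_eq_true, update_of_ne]
  constructor
  · intro h i j hi hj hij
    exact h (.inr i) (.inr j) ⟨⟨⟨i, rfl, hi⟩, ⟨j, rfl, hj⟩⟩, congrArg Sum.inl hij⟩
  · rintro h _ _ ⟨⟨⟨i, rfl, hi⟩, ⟨j, rfl, hj⟩⟩, hij⟩
    exact h i j hi hj (Sum.inl.inj hij)

open Function in
theorem holds_startsWith [Fintype B] {P : B → Prop} {w : List B} :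
    (startsWith P w).Holds G e ↔ ∃ i, e .x = .inr i ∧ ∃ c γ,
      G.output.drop i = w ++ c :: γ ∧ P c := by
  induction w generalizing e with
  | nil =>
    simp only [startsWith, holds_outIn, FOTerm.eval, List.nil_append]
    refine exists_congr fun i => and_congr_right fun _ => ?_
    rw [List.drop_eq_getElem_cons i.2]
    constructor
    · exact fun h => ⟨_, _, rfl, h⟩
    · rintro ⟨c, γ, h, hc⟩
      cases h
      exact hc
  | cons b w ih =>
    simp only [startsWith, Holds, ih, FOTerm.eval, update_self, ne_eq, reduceCtorEq,
      not_false_eq_true, update_of_ne]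
    constructor
    · rintro ⟨hb, d, hs, d', rfl, i, rfl, c, γ, h, hc⟩
      rcases hx : e .x with j | j <;> rw [hx] at hb hs
      · exact hb.elim
      · have hi : i.val = j.val + 1 := hs
        refine ⟨j, rfl, c, γ, ?_, hc⟩
        rw [List.drop_eq_getElem_cons j.2, ← hi, h, ← show G.output.get j = b from hb]
        rfl
    · rintro ⟨i, hi, c, γ, h, hc⟩
      rw [List.drop_eq_getElem_cons i.2, List.cons_append, List.cons.injEq] at h
      have hlt : i.val + 1 < G.output.length := by
        by_contra! hle
        rw [List.drop_eq_nil_of_le hle] at h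
        simp at h
      rw [hi]
      exact ⟨h.1, .inr ⟨i + 1, hlt⟩, rfl, _, rfl, _, rfl, c, γ, h.2, hc⟩

open Function in
theorem satisfiable_runSentence_iff [Fintype A] [Fintype B] {S : QueueSystem A B} {w : List B}
    (hS : ∀ b, S.push b = none ∨ S.pop b = none) (hw : w.filterMap S.push ≠ []) :
    (runSentence S w).Satisfiable ↔ ∃ β, S.IsRun w β := by
  have hne : ∀ {c γ β}, β = w ++ c :: γ → β.filterMap S.push ≠ [] := by
    rintro c γ _ rfl h
    rw [List.filterMap_append, List.append_eq_nil_iff] at h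
    exact hw h.1
  have key : ∀ (G : OGraph A B) (e : FOVar → G.Dom), (runSentence S w).Holds G e ↔
      (∃ c γ, G.output = w ++ c :: γ ∧ S.mayFollow c) ∧
      (G.output.IsChain S.next ∧ ∀ b ∈ G.output.getLast?, S.mayEnd b) ∧
      Spells S.push G.output G.input G.origin ∧ Spells S.pop G.output G.input G.origin ∧
      ∀ i j, (S.push (G.output.get i)).isSome → (S.pop (G.output.get j)).isSome →
        G.origin i = G.origin j → i ≤ j := by
    intro G e
    have hdom : Nonempty G.Dom := ⟨.inl ⟨0, List.length_pos_iff.2 G.input_ne_nil⟩⟩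
    simp only [runSentence, Holds, holds_localRule, holds_pushFirst, holds_spelling,
      holds_startsWith, FOTerm.eval, update_self, ne_eq, reduceCtorEq, not_false_eq_true,
      update_of_ne, exists_const]
    -- the output position without a predecessor is position `0`
    have hfirst : (∃ d : G.Dom, (¬ ∃ d', G.SuccOut d' d) ∧ ∃ i, d = .inr i ∧ ∃ c γ,
        G.output.drop i = w ++ c :: γ ∧ S.mayFollow c) ↔
        ∃ c γ, G.output = w ++ c :: γ ∧ S.mayFollow c := by
      constructor
      · rintro ⟨_, hd, ⟨i, hi⟩, rfl, h⟩
        rcases i with _ | i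
        · exact h
        · exact absurd ⟨.inr ⟨i, by omega⟩, rfl⟩ hd
      · rintro ⟨c, γ, h, hc⟩
        refine ⟨.inr ⟨0, by rw [h]; simp⟩, ?_, _, rfl, c, γ, h, hc⟩
        rintro ⟨d | d, hd⟩
        · exact hd
        · exact absurd (show 0 = d.val + 1 from hd) (by omega)
    rw [hfirst]
    tauto
  constructor
  · rintro ⟨G, hG⟩
    obtain ⟨⟨c, γ, hβ, hc⟩, ⟨h₂, h₃⟩, h₄⟩ :=
      (key G _).1 (hG fun _ => .inl ⟨0, List.length_pos_iff.2 G.input_ne_nil⟩)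
    exact ⟨G.output, ⟨c, γ, hβ, hc⟩, h₂, h₃, (emptiesQueue_iff_exists_origin hS _ (hne hβ)).2
      ⟨G.input, G.input_ne_nil, G.origin, h₄⟩⟩
  · rintro ⟨β, ⟨c, γ, hβ, hc⟩, h₂, h₃, h₄⟩
    obtain ⟨u, hu, o, ho⟩ := (emptiesQueue_iff_exists_origin hS _ (hne hβ)).1 h₄
    exact ⟨⟨u, hu, β, o⟩, fun e => (key _ e).2 ⟨⟨c, γ, hβ, hc⟩, ⟨h₂, h₃⟩, ho⟩⟩

end FO2

/-! ### Queue machines as queue systems -/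

namespace QueueSystem

/-- The letters of the runs of a queue machine: a letter of the initial queue to be loaded, or the
popping half (`false`) or the pushing half (`true`) of a transition. -/
abbrev Letter (Q A : Type) : Type := A ⊕ ((Q × Option A × Option A × Q) × Bool)

variable {Q A : Type}

/-- The runs of a queue machine as words: the initial queue is loaded letter by letter, and then
each transition first pops and then pushes. Every letter pushes or pops at most one letter, and
never does both. -/
def ofMachine (Rule : Q → Option A → Option A → Q → Prop) (q₀ : Q) (F : Set Q) :
    QueueSystem A (Letter Q A) where
  push
    | .inl a => some a
    | .inr ((_, _, b, _), true) => b
    | .inr (_, false) => none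
  pop
    | .inr ((_, a, _, _), false) => a
    | _ => none
  next
    | .inl _, .inl _ => True
    | .inl _, .inr ((p, a, b, q), false) => p = q₀ ∧ Rule p a b q
    | .inr (t, false), .inr (t', true) => t = t'
    | .inr ((_, _, _, p'), true), .inr ((p, a, b, q), false) => p = p' ∧ Rule p a b q
    | _, _ => False
  mayFollow b := b.isRight
  mayEnd
    | .inr ((_, _, _, q), true) => q ∈ F
    | _ => False

variable {Rule : Q → Option A → Option A → Q → Prop} {q₀ : Q} {F : Set Q}

theorem ofMachine_push_eq_none_or (b : Letter Q A) :
    (ofMachine Rule q₀ F).push b = none ∨ (ofMachine Rule q₀ F).pop b = none := by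
  rcases b with a | ⟨⟨p, a, b, q⟩, _ | _⟩
  · exact .inr rfl
  · exact .inl rfl
  · exact .inr rfl

theorem emptiesQueue_load {l₀ l : List A} {γ : List (Letter Q A)} :
    EmptiesQueue (ofMachine Rule q₀ F).push (ofMachine Rule q₀ F).pop l (l₀.map .inl ++ γ) ↔
      EmptiesQueue (ofMachine Rule q₀ F).push (ofMachine Rule q₀ F).pop (l ++ l₀) γ := by
  induction l₀ generalizing l with
  | nil => simp
  | cons a l₀ ih =>
    rw [List.map_cons, List.cons_append, emptiesQueue_cons (ofMachine_push_eq_none_or _)]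
    constructor
    · rintro ⟨r, hr, h⟩
      obtain rfl : l = r := hr
      simpa using (ih (l := l ++ [a])).1 h
    · intro h
      exact ⟨l, rfl, (ih (l := l ++ [a])).2 (by simpa using h)⟩

theorem emptiesQueue_transition {p q : Q} {a b : Option A} {l : List A}
    {γ : List (Letter Q A)} :
    EmptiesQueue (ofMachine Rule q₀ F).push (ofMachine Rule q₀ F).pop l
      (.inr ((p, a, b, q), false) :: .inr ((p, a, b, q), true) :: γ) ↔ ∃ r, l = a.toList ++ r ∧
      EmptiesQueue (ofMachine Rule q₀ F).push (ofMachine Rule q₀ F).pop (r ++ b.toList) γ := by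
  rw [emptiesQueue_cons (ofMachine_push_eq_none_or _)]
  refine exists_congr fun r => and_congr Iff.rfl ?_
  rw [emptiesQueue_cons (ofMachine_push_eq_none_or _)]
  constructor
  · rintro ⟨r', hr, h⟩
    have : r = r' := by simpa [ofMachine] using hr
    exact this ▸ h
  · exact fun h => ⟨r, by simp [ofMachine], h⟩

/-- The words that describe the transitions of a computation from state `p` to a state in `F`,
irrespective of the queue. -/
def IsTail (Rule : Q → Option A → Option A → Q → Prop) (q₀ : Q) (F : Set Q) (p : Q)
    (γ : List (Letter Q A)) : Prop :=
  (γ = [] ∧ p ∈ F) ∨ ∃ a b q γ', γ = .inr ((p, a, b, q), false) :: γ' ∧ Rule p a b q ∧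
    γ.IsChain (ofMachine Rule q₀ F).next ∧ ∀ b ∈ γ.getLast?, (ofMachine Rule q₀ F).mayEnd b

/-- Every transition takes two consecutive letters. -/
theorem isTail_cons {p q : Q} {a b : Option A} {γ : List (Letter Q A)} (h : Rule p a b q) :
    IsTail Rule q₀ F p (.inr ((p, a, b, q), false) :: γ) ↔
      ∃ γ', γ = .inr ((p, a, b, q), true) :: γ' ∧ IsTail Rule q₀ F q γ' := by
  constructor
  · rintro (⟨h, -⟩ | ⟨a', b', q', γ', h', -, hc, hs⟩)
    · cases h
    · cases h'
      rcases γ with _ | ⟨c, γ⟩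
      · exact (hs _ rfl).elim
      · rw [List.isChain_cons_cons] at hc
        obtain ⟨hn, hc⟩ := hc
        rcases c with c | ⟨t, _ | _⟩
        · exact hn.elim
        · exact hn.elim
        · cases hn
          refine ⟨γ, rfl, ?_⟩
          rcases γ with _ | ⟨c, γ⟩
          · exact .inl ⟨rfl, hs _ rfl⟩
          · rw [List.isChain_cons_cons] at hc
            obtain ⟨hn, hc⟩ := hc
            rcases c with c | ⟨⟨p', a', b', q'⟩, _ | _⟩
            · exact hn.elim
            · obtain ⟨rfl, hR⟩ := hn
              exact .inr ⟨a', b', q', γ, rfl, hR, hc, fun b hb => hs b (by simpa using hb)⟩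
            · exact hn.elim
  · rintro ⟨γ, rfl, hγ⟩
    refine .inr ⟨a, b, q, _, rfl, h, ?_, ?_⟩
    · refine List.isChain_cons_cons.2 ⟨rfl, ?_⟩
      rcases hγ with ⟨rfl, -⟩ | ⟨a', b', q', γ', rfl, hR, hc, -⟩
      · exact .singleton _
      · exact List.isChain_cons_cons.2 ⟨⟨rfl, hR⟩, hc⟩
    · rcases hγ with ⟨rfl, hq⟩ | ⟨a', b', q', γ', rfl, -, -, hs⟩
      · rintro _ ⟨⟩
        exact hq
      · exact fun b hb => hs b (by simpa using hb)

theorem reachable_iff_exists_isTail {p : Q} {l : List A} :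
    (∃ q ∈ F, ReflTransGen (QueueStep Rule) (p, l) (q, [])) ↔ ∃ γ, IsTail Rule q₀ F p γ ∧
      EmptiesQueue (ofMachine Rule q₀ F).push (ofMachine Rule q₀ F).pop l γ := by
  constructor
  · rintro ⟨q, hq, h⟩
    suffices ∀ c, ReflTransGen (QueueStep Rule) c (q, []) → ∃ γ, IsTail Rule q₀ F c.1 γ ∧
        EmptiesQueue (ofMachine Rule q₀ F).push (ofMachine Rule q₀ F).pop c.2 γ from this _ h
    intro c h
    induction h using ReflTransGen.head_induction_on with
    | refl => exact ⟨[], .inl ⟨rfl, hq⟩, emptiesQueue_nil.2 rfl⟩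
    | head hcd _ ih =>
      obtain ⟨a, b, r, hR, h₁, h₂⟩ := hcd
      obtain ⟨γ, hγ, he⟩ := ih
      exact ⟨_, (isTail_cons hR).2 ⟨γ, rfl, hγ⟩, emptiesQueue_transition.2 ⟨r, h₁, h₂ ▸ he⟩⟩
  · rintro ⟨γ, hγ, he⟩
    induction hn : γ.length using Nat.strong_induction_on generalizing γ p l with
    | _ n ih =>
      rcases hγ with ⟨rfl, hp⟩ | ⟨a, b, q, γ', rfl, hR, h⟩
      · rw [emptiesQueue_nil.1 he]
        exact ⟨p, hp, .refl⟩
      · obtain ⟨γ, rfl, hγ⟩ := (isTail_cons hR).1 (.inr ⟨a, b, q, γ', rfl, hR, h⟩)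
        obtain ⟨r, rfl, he'⟩ := emptiesQueue_transition.1 he
        obtain ⟨q', hq', h⟩ := ih γ.length (by simp [← hn]) γ hγ he' rfl
        exact ⟨q', hq', h.head ⟨a, b, r, hR, rfl, rfl⟩⟩

theorem exists_isRun_ofMachine_iff {l : List A} (hl : l ≠ []) :
    (∃ β, (ofMachine Rule q₀ F).IsRun (l.map .inl) β) ↔
      ∃ q ∈ F, ReflTransGen (QueueStep Rule) (q₀, l) (q, []) := by
  rw [reachable_iff_exists_isTail (q₀ := q₀)]
  constructor
  · rintro ⟨_, ⟨c, γ, rfl, hc⟩, hch, hs, he⟩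
    refine ⟨c :: γ, ?_, by simpa using emptiesQueue_load.1 he⟩
    rw [List.isChain_append] at hch
    obtain ⟨-, hch, hn⟩ := hch
    have hn := hn _ (List.getLast?_eq_getLast_of_ne_nil (by simpa using hl)) c rfl
    rw [List.getLast_map] at hn
    rcases c with c | ⟨⟨p, a, b, q⟩, _ | _⟩
    · cases hc
    · obtain ⟨rfl, hR⟩ := hn
      exact .inr ⟨a, b, q, γ, rfl, hR, hch, fun b hb => hs b (by
        rw [List.getLast?_append, hb]; rfl)⟩
    · exact hn.elim
  · rintro ⟨γ, hγ, he⟩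
    refine ⟨l.map .inl ++ γ, ?_⟩
    rcases hγ with ⟨rfl, -⟩ | ⟨a, b, q, γ', rfl, hR, hc, hs⟩
    · exact absurd (emptiesQueue_nil.1 he) hl
    · refine ⟨⟨_, γ', rfl, rfl⟩, ?_, ?_, emptiesQueue_load.2 (by simpa using he)⟩
      · rw [List.isChain_append]
        refine ⟨?_, hc, ?_⟩
        · rw [List.isChain_map]
          exact List.isChain_iff_getElem.2 fun _ _ => trivial
        · rintro _ hx _ ⟨⟩
          obtain ⟨a', -, rfl⟩ := List.mem_map.1 (List.mem_of_getLast? hx)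
          exact ⟨rfl, hR⟩
      · intro c hcl
        refine hs c ?_
        rw [List.getLast?_append] at hcl
        rcases h : List.getLast? (Sum.inr ((q₀, a, b, q), false) :: γ') with _ | d
        · simp at h
        · rw [h] at hcl
          exact hcl

/-- Renaming the letters of a queue system. -/
def rename {A A' B B' : Type} (S : QueueSystem A B) (f : A ≃ A') (g : B' ≃ B) :
    QueueSystem A' B' where
  push b := (S.push (g b)).map f
  pop b := (S.pop (g b)).map f
  next b b' := S.next (g b) (g b')
  mayFollow b := S.mayFollow (g b)
  mayEnd b := S.mayEnd (g b)

theorem isRun_rename {A A' B B' : Type} (S : QueueSystem A B) (f : A ≃ A') (g : B' ≃ B)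
    (w β : List B') : (S.rename f g).IsRun w β ↔ S.IsRun (w.map g) (β.map g) := by
  have hf : ∀ (h : B → Option A) (δ : List B'),
      δ.filterMap (fun b => (h (g b)).map f) = ((δ.map g).filterMap h).map f := by
    intro h δ
    rw [List.map_filterMap, List.filterMap_map]
    rfl
  refine and_congr ?_ (and_congr ?_ (and_congr ?_ (and_congr ?_ ?_)))
  · constructor
    · rintro ⟨c, γ, rfl, hc⟩
      exact ⟨g c, γ.map g, by simp, hc⟩
    · rintro ⟨c, γ, h, hc⟩
      refine ⟨g.symm c, γ.map g.symm, ?_, by simpa [rename] using hc⟩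
      apply List.map_injective_iff.2 g.injective
      simp [h]
  · rw [List.isChain_map]
    rfl
  · rw [List.getLast?_map]
    constructor
    · intro h b hb
      obtain ⟨b', hb', rfl⟩ := Option.mem_map.1 hb
      exact h b' hb'
    · exact fun h b hb => h _ (Option.mem_map_of_mem _ hb)
  · simp only [rename, hf, List.nil_append]
    exact (List.map_injective_iff.2 f.injective).eq_iff
  · simp only [rename, hf, List.length_map, List.length_nil]
    constructor
    · intro h δ hδ
      have := h (δ.map g.symm) (by simpa using hδ.map g.symm)
      simpa using this
    · exact fun h δ hδ => h _ (hδ.map g)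

end QueueSystem

/-! ### The reduction is computable -/

namespace FO2

/-- In prefix notation the letters of the initial word contribute consecutive blocks to the code,
although the subformulas describing them are nested. -/
theorem exists_code_runSentence {m n : ℕ} (S : QueueSystem (Fin m) (Fin n)) :
    ∃ (pre post : List ℕ) (blk : Fin n → List ℕ),
      ∀ w, (runSentence S w).code = pre ++ w.flatMap blk ++ post := by
  let blk : Fin n → List ℕ := fun b => [7, 2, b.val, 0, 9, 1, 7, 5, 0, 1, 9, 0, 7, 0, 0, 1]
  have hw : ∀ w, (startsWith S.mayFollow w : FO2 (Fin m) (Fin n)).code =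
      w.flatMap blk ++ (outIn S.mayFollow tx : FO2 (Fin m) (Fin n)).code := by
    intro w
    induction w with
    | nil => rfl
    | cons b w ih => simp [blk, startsWith, code, ih, FOTerm.code]
  refine ⟨[9, 0, 9, 1, 7] ++ (and (and (localRule S) (pushFirst S))
    (and (spelling S.push) (spelling S.pop))).code ++ [9, 0, 7, 6, 9, 1, 5, 1, 0],
    (outIn S.mayFollow tx : FO2 (Fin m) (Fin n)).code, blk, fun w => ?_⟩
  rw [List.append_assoc, ← hw]
  simp [runSentence, code, FOTerm.code]

theorem computable_code_runSentence {m n : ℕ} (S : QueueSystem (Fin m) (Fin n))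
    (w₁ w₂ : List (Fin n)) (b : Fin n) :
    Computable fun k => (runSentence S (w₁ ++ List.replicate k b ++ w₂)).code := by
  obtain ⟨pre, post, blk, h⟩ := exists_code_runSentence S
  have hrep : Primrec fun k => (List.replicate k b).flatMap blk :=
    (Primrec.nat_rec₁ (f := fun _ l => blk b ++ l) []
      (Primrec.list_append.comp (Primrec.const _) Primrec.snd)).of_eq fun k => by
        induction k with
        | zero => rfl
        | succ k ih => exact congrArg (blk b ++ ·) ih
  have : Primrec fun k => (pre ++ w₁.flatMap blk) ++ (List.replicate k b).flatMap blk ++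
      (w₂.flatMap blk ++ post) :=
    Primrec.list_append.comp (Primrec.list_append.comp (Primrec.const _) hrep) (Primrec.const _)
  exact this.to_comp.of_eq fun k => by simp [h]

theorem code_mem_satProblemOver {m n : ℕ} {φ : FO2 (Fin m) (Fin n)} (h : φ.IsSentence) :
    φ.code ∈ SatProblemOver m n ↔ φ.Satisfiable := by
  constructor
  · rintro ⟨ψ, -, hψ, hc⟩
    rwa [code_injective hc]
  · exact fun hφ => ⟨φ, h, hφ, rfl⟩

theorem code_mem_satProblem {m n : ℕ} {φ : FO2 (Fin m) (Fin n)} (h : φ.IsSentence) :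
    m :: n :: φ.code ∈ SatProblem ↔ φ.Satisfiable := by
  constructor
  · rintro ⟨m', n', ψ, -, hψ, hc⟩
    simp only [List.cons.injEq] at hc
    obtain ⟨rfl, rfl, hc⟩ := hc
    rwa [code_injective hc]
  · exact fun hφ => ⟨m, n, φ, h, hφ, rfl⟩

end FO2

/-- Over suitable fixed alphabets, a computable sequence of sentences is satisfiable exactly at the
indices of the programs that halt on input `0`. -/
theorem exists_halting_sentences : ∃ (m n : ℕ) (φ : ℕ → FO2 (Fin m) (Fin n)),
    (Computable fun k => (φ k).code) ∧ (∀ k, (φ k).IsSentence) ∧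
      ∀ k, HaltsOnZero k ↔ (φ k).Satisfiable := by
  obtain ⟨Q, A, _, _, Rule, q₀, F, l₁, l₂, a, hl, h⟩ := exists_universal_queueMachine
  let f : A ≃ Fin (Fintype.card A) := Fintype.equivFin A
  let g : Fin (Fintype.card (QueueSystem.Letter Q A)) ≃ QueueSystem.Letter Q A :=
    (Fintype.equivFin _).symm
  let S := (QueueSystem.ofMachine Rule q₀ F).rename f g
  let c : A → Fin (Fintype.card (QueueSystem.Letter Q A)) := fun a => g.symm (.inl a)
  have hc : ∀ l : List A, (l.map c).map g = l.map .inl := fun l => by simp [c]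
  refine ⟨_, _, fun k => FO2.runSentence S (l₁.map c ++ List.replicate k (c a) ++ l₂.map c),
    FO2.computable_code_runSentence S _ _ _, fun k => FO2.isSentence_runSentence _ _, fun k => ?_⟩
  have hw : l₁.map c ++ List.replicate k (c a) ++ l₂.map c =
      (l₁ ++ List.replicate k a ++ l₂).map c := by simp
  beta_reduce
  rw [h, hw, ← QueueSystem.exists_isRun_ofMachine_iff (by simp [hl]),
    FO2.satisfiable_runSentence_iff]
  · simp only [S, QueueSystem.isRun_rename, hc]
    exact ⟨fun ⟨β, hβ⟩ => ⟨β.map g.symm, by simpa using hβ⟩, fun ⟨β, hβ⟩ => ⟨β.map g, hβ⟩⟩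
  · intro b
    rcases QueueSystem.ofMachine_push_eq_none_or (Rule := Rule) (q₀ := q₀) (F := F) (g b) with h | h
    · exact .inl (by simp [S, QueueSystem.rename, h])
    · exact .inr (by simp [S, QueueSystem.rename, h])
  · obtain ⟨b, l, rfl⟩ := List.exists_cons_of_ne_nil hl
    simp [S, QueueSystem.rename, QueueSystem.ofMachine, c]

theorem mainTheorem10 :
    (¬ ComputablePred fun w : List ℕ => w ∈ SatProblem) ∧
      ∃ m n : ℕ, ¬ ComputablePred fun w : List ℕ => w ∈ SatProblemOver m n := by
  obtain ⟨m, n, φ, hc, hs, h⟩ := exists_halting_sentences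
  refine ⟨fun hdec => not_computablePred_haltsOnZero ?_,
    m, n, fun hdec => not_computablePred_haltsOnZero ?_⟩
  · refine ComputablePred.computable_of_manyOneReducible ⟨fun k => m :: n :: (φ k).code, ?_,
      fun k => (h k).trans (FO2.code_mem_satProblem (hs k)).symm⟩ hdec
    exact Computable.list_cons.comp (.const m) (Computable.list_cons.comp (.const n) hc)
  · exact ComputablePred.computable_of_manyOneReducible ⟨fun k => (φ k).code, hc,
      fun k => (h k).trans (FO2.code_mem_satProblemOver (hs k)).symm⟩ hdec
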